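/- Let $\mathbb{F}_2$ be the field with two elements. A polynomial $f$ is called self-reciprocal if $f^*=f$, where $f^*(x)=x^{\deg f}f(1/x)$. For $n\ge 1$ and $a\in\mathbb{F}_2$ let $S_2(n;a)$ denote the number of self-reciprocal irreducible monic polynomials $f$ of degree $2n$ over $\mathbb{F}_2$ whose coefficient of $x^{2n-1}$ equals $a$. Let $\theta=\arccos\left(\frac{1}{2\sqrt{2}}\right)$ and let $\mu$ be the Möbius function. Then, for every integer $n\ge 1$, $$S_2(n;1)=\frac{1}{4n}\sum_{\substack{j\mid n\\ j\text{ odd}}}\mu(j)\left(2^{n/j}+1-(-1)^{n/j}\,2^{\frac{n}{2j}+1}\cos\left(\frac{n\theta}{j}\right)\right),$$ $$S_2(n;0)=\frac{1}{4n}\sum_{\substack{j\mid n\\ j\text{ odd}}}\mu(j)\left(2^{n/j}-1+(-1)^{n/j}\,2^{\frac{n}{2j}+1}\cos\left(\frac{n\theta}{j}\right)\right).$$ -/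

import Mathlib

open Polynomial

/-- The monic irreducible polynomials `f` over `F` of degree `d` that are self-reciprocal, i.e.
`f = f^*` where `f^*(x) = x^(deg f) f(1/x)`. -/
def selfRecipIrred (F : Type*) [Field F] (d : ℕ) : Set F[X] :=
  {f | f.Monic ∧ Irreducible f ∧ f.reverse = f ∧ f.natDegree = d}

/-- The members of `selfRecipIrred F d` with `ℓ` prescribed leading coefficients: the coefficient
of `x^(d-j)` is `a_j` for `1 ≤ j ≤ ℓ` (`a_j` is `a i` with `j = i + 1`; a coefficient at a
negative exponent is `0`). -/
def selfRecipIrredLead (F : Type*) [Field F] (d : ℕ) {ℓ : ℕ} (a : Fin ℓ → F) : Set F[X] :=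
  {f | f ∈ selfRecipIrred F d ∧
    ∀ i : Fin ℓ, (if (i : ℕ) + 1 ≤ d then f.coeff (d - ((i : ℕ) + 1)) else 0) = a i}

/-- `S_F(n; a)`: the number of self-reciprocal irreducible monic polynomials of degree `2n` over
`F` with prescribed leading coefficients `a`. -/
noncomputable def numSelfRecip (F : Type*) [Field F] (n : ℕ) {ℓ : ℕ} (a : Fin ℓ → F) : ℕ :=
  (selfRecipIrredLead F (2 * n) a).ncard

/-- Over a finite field the set being counted is finite, so that `numSelfRecip` is its genuine
cardinality. -/
theorem selfRecipIrredLead_finite (F : Type*) [Field F] [Finite F] (d : ℕ) {ℓ : ℕ}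
    (a : Fin ℓ → F) : (selfRecipIrredLead F d a).Finite := by
  have h : Set.InjOn (fun (f : F[X]) (i : Fin (d + 1)) => f.coeff i)
      (selfRecipIrredLead F d a) := by
    intro f hf g hg hfg
    ext k
    by_cases hk : k < d + 1
    · exact congrFun hfg ⟨k, hk⟩
    · rw [coeff_eq_zero_of_natDegree_lt (by have := hf.1.2.2.2; omega),
        coeff_eq_zero_of_natDegree_lt (by have := hg.1.2.2.2; omega)]
  exact Set.Finite.of_finite_image (Set.toFinite _) h

/-! A self-reciprocal `f` of degree `2n` has the form `x^n g(x + 1/x)` for a unique `g` of degree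
`n` (`reciprocalLift`), and its coefficient at `x^(2n-1)` is the next-to-leading coefficient of `g`.
If `α` is a root of `g`, then `f` is irreducible iff `g` is and `β + 1/β = α` has no solution in
`F_2(α)`. Putting `u = 1/(β + 1)` turns this equation into `u^2 + u = 1/α`, so by additive Hilbert
90 the condition is that `1/α` has trace `1`, that is, `g_0 = g_1 = 1`. Thus `S_2(n; a)` counts the
irreducible `g` with trace `a` and reciprocal trace `1` (`selfRecipIrredLead_eq_image`).

These `g` are isolated by the four characters `endsCharacter i j`, whose L-series are `(1 - T)/(1 -
2T)`, `1 - T`, `1 - T` and the Kloosterman factor `1 + T + 2T^2`. Newton's identity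
(`IsMonicCharacter.newton`) converts them into sums over prime powers: `2^k - 1`, `-1`, `-1` and
minus the power sum of the reciprocal roots `-√2 e^(±iθ)`; this last one produces the cosine. In the
combination of characters used, even powers of primes cancel, so the count is recovered by Möbius
inversion over odd divisors (`sum_odd_divisors_moebius`). -/

/-- A function that is multiplicative on monic polynomials. -/
structure IsMonicCharacter {F R : Type*} [Field F] [CommRing R] (χ : F[X] → R) : Prop where
  map_one : χ 1 = 1
  map_mul : ∀ {f g : F[X]}, f.Monic → g.Monic → χ (f * g) = χ f * χ g

theorem IsMonicCharacter.map_pow {F R : Type*} [Field F] [CommRing R] {χ : F[X] → R}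
    (hχ : IsMonicCharacter χ) {f : F[X]} (hf : f.Monic) (m : ℕ) : χ (f ^ m) = χ f ^ m := by
  induction m with
  | zero => simpa using hχ.map_one
  | succ m ih => rw [pow_succ, hχ.map_mul (hf.pow m) hf, ih, pow_succ]

/-! ### L-series over monic polynomials and Newton's identity -/

section PowerSums

variable (F : Type*) [Field F] [Finite F]

theorem finite_monic_natDegree_eq (n : ℕ) : {f : F[X] | f.Monic ∧ f.natDegree = n}.Finite := by
  have h : Set.InjOn (fun (f : F[X]) (i : Fin (n + 1)) => f.coeff i)
      {f : F[X] | f.Monic ∧ f.natDegree = n} := by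
    intro f hf g hg hfg
    ext k
    by_cases hk : k < n + 1
    · exact congrFun hfg ⟨k, hk⟩
    · rw [coeff_eq_zero_of_natDegree_lt (by have := hf.2; omega),
        coeff_eq_zero_of_natDegree_lt (by have := hg.2; omega)]
  exact Set.Finite.of_finite_image (Set.toFinite _) h

/-- The monic polynomials of degree `n` over a finite field. -/
noncomputable def monicsOfDegree (n : ℕ) : Finset F[X] := (finite_monic_natDegree_eq F n).toFinset

open Classical in
/-- The monic irreducible polynomials of degree `n` over a finite field. -/
noncomputable def primesOfDegree (n : ℕ) : Finset F[X] :=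
  (monicsOfDegree F n).filter Irreducible

variable {F}

@[simp] theorem mem_monicsOfDegree {n : ℕ} {f : F[X]} :
    f ∈ monicsOfDegree F n ↔ f.Monic ∧ f.natDegree = n := by
  simp [monicsOfDegree]

@[simp] theorem mem_primesOfDegree {n : ℕ} {f : F[X]} :
    f ∈ primesOfDegree F n ↔ (f.Monic ∧ f.natDegree = n) ∧ Irreducible f := by
  simp [primesOfDegree]

open Classical in
/-- The degree of `f` is the sum of `deg P` over the prime powers `P ^ m` dividing `f`. -/
theorem sum_natDegree_prime_pow_dvd {n : ℕ} {f : F[X]} (hf : f ∈ monicsOfDegree F n) :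
    ∑ d ∈ Finset.Icc 1 n, ∑ m ∈ Finset.Icc 1 n, ∑ P ∈ primesOfDegree F d,
      (if P ^ m ∣ f then d else 0) = n := by
  obtain ⟨hm, hn⟩ := mem_monicsOfDegree.1 hf
  have hf0 : f ≠ 0 := hm.ne_zero
  set s := UniqueFactorizationMonoid.normalizedFactors f with hs
  have hmon : ∀ P ∈ s, P.Monic ∧ Irreducible P := fun P hP => by
    have h1 := UniqueFactorizationMonoid.irreducible_of_normalized_factor P hP
    refine ⟨?_, h1⟩
    rw [← UniqueFactorizationMonoid.normalize_normalized_factor P hP]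
    exact monic_normalize h1.ne_zero
  have hprod : s.prod = f := by
    rw [hs, UniqueFactorizationMonoid.prod_normalizedFactors_eq hf0, hm.normalize_eq_self]
  have hdeg : (s.map natDegree).sum = n := by
    rw [← natDegree_multiset_prod_of_monic _ (fun P hP => (hmon P hP).1), hprod, hn]
  have hle : ∀ P : F[X], P ∣ f → P.natDegree ≤ n := fun P hP => hn ▸ natDegree_le_of_dvd hP hf0
  have hcount : ∀ d ∈ Finset.Icc 1 n, ∀ P ∈ primesOfDegree F d,
      ∑ m ∈ Finset.Icc 1 n, (if P ^ m ∣ f then d else 0) = s.count P * P.natDegree := by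
    intro d hd P hP
    obtain ⟨⟨hPm, hPd⟩, hPi⟩ := mem_primesOfDegree.1 hP
    have key : ∀ m, P ^ m ∣ f ↔ m ≤ s.count P := fun m => by
      rw [pow_dvd_iff_le_emultiplicity,
        UniqueFactorizationMonoid.emultiplicity_eq_count_normalizedFactors hPi hf0,
        hPm.normalize_eq_self, Nat.cast_le]
    -- Since `deg P ≥ 1`, no multiplicity exceeds `n`, so cutting `m` off at `n` loses no prime
    -- power.
    have hc : s.count P ≤ n := by
      have h1 := hle _ ((key _).2 le_rfl)
      rw [hPm.natDegree_pow, hPd] at h1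
      have := (Finset.mem_Icc.1 hd).1
      nlinarith
    have hfil : (Finset.Icc 1 n).filter (fun m => m ≤ s.count P) = Finset.Icc 1 (s.count P) := by
      ext m; simp; omega
    simp_rw [key]
    rw [← Finset.sum_filter, hfil, hPd]
    simp
  calc _ = ∑ d ∈ Finset.Icc 1 n, ∑ P ∈ primesOfDegree F d, s.count P * P.natDegree := by
        refine Finset.sum_congr rfl fun d hd => ?_
        rw [Finset.sum_comm]
        exact Finset.sum_congr rfl fun P hP => hcount d hd P hP
    _ = ∑ P ∈ (Finset.Icc 1 n).biUnion (primesOfDegree F), s.count P * P.natDegree := by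
        rw [Finset.sum_biUnion]
        intro d _ e _ hde
        rw [Function.onFun, Finset.disjoint_left]
        intro P hP hP'
        exact hde ((mem_primesOfDegree.1 hP).1.2.symm.trans (mem_primesOfDegree.1 hP').1.2)
    _ = ∑ P ∈ s.toFinset, s.count P * P.natDegree := by
        symm
        refine Finset.sum_subset (fun P hP => ?_) fun P _ hP => ?_
        · have hP' := Multiset.mem_toFinset.1 hP
          obtain ⟨h1, h2⟩ := hmon P hP'
          refine Finset.mem_biUnion.2 ⟨P.natDegree, Finset.mem_Icc.2 ⟨h2.natDegree_pos, ?_⟩,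
            mem_primesOfDegree.2 ⟨⟨h1, rfl⟩, h2⟩⟩
          exact hle P (UniqueFactorizationMonoid.dvd_of_mem_normalizedFactors hP')
        · rw [Multiset.count_eq_zero_of_notMem (by simpa using hP), zero_mul]
    _ = n := by
        rw [← hdeg, Finset.sum_multiset_map_count]
        simp

variable {R : Type*} [CommRing R]

/-- The coefficient at `n` of the L-series of a function on monic polynomials. -/
noncomputable def monicSum (χ : F[X] → R) (n : ℕ) : R := ∑ f ∈ monicsOfDegree F n, χ f

/-- The coefficient at `k` of the logarithmic derivative of the L-series of `χ`. -/
noncomputable def primePowerSum (χ : F[X] → R) (k : ℕ) : R :=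
  ∑ d ∈ k.divisors, d * ∑ P ∈ primesOfDegree F d, χ P ^ (k / d)

open Classical in
theorem IsMonicCharacter.sum_dvd {χ : F[X] → R} (hχ : IsMonicCharacter χ) {Q : F[X]}
    (hQ : Q.Monic) (n : ℕ) :
    ∑ f ∈ monicsOfDegree F n, (if Q ∣ f then χ f else 0) =
      if Q.natDegree ≤ n then χ Q * monicSum χ (n - Q.natDegree) else 0 := by
  rw [← Finset.sum_filter]
  split_ifs with h
  · rw [monicSum, Finset.mul_sum]
    symm
    refine Finset.sum_bij (fun g _ => Q * g) ?_ ?_ ?_ ?_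
    · intro g hg
      obtain ⟨h1, h2⟩ := mem_monicsOfDegree.1 hg
      refine Finset.mem_filter.2 ⟨mem_monicsOfDegree.2 ⟨hQ.mul h1, ?_⟩, dvd_mul_right _ _⟩
      rw [hQ.natDegree_mul h1]; omega
    · intro g _ g' _ hgg
      exact mul_left_cancel₀ hQ.ne_zero hgg
    · intro f hf
      obtain ⟨hf, g, rfl⟩ := Finset.mem_filter.1 hf
      obtain ⟨h1, h2⟩ := mem_monicsOfDegree.1 hf
      have hg : g.Monic := hQ.of_mul_monic_left h1
      rw [hQ.natDegree_mul hg] at h2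
      exact ⟨g, mem_monicsOfDegree.2 ⟨hg, by omega⟩, rfl⟩
    · intro g hg
      exact (hχ.map_mul hQ (mem_monicsOfDegree.1 hg).1).symm
  · refine Finset.sum_eq_zero fun f hf => ?_
    obtain ⟨hf, hd⟩ := Finset.mem_filter.1 hf
    obtain ⟨h1, h2⟩ := mem_monicsOfDegree.1 hf
    exact absurd (h2 ▸ natDegree_le_of_dvd hd h1.ne_zero) h

/-- Newton's identity for the L-series of a character: its logarithmic derivative is the
generating function of the power sums over primes. -/
theorem IsMonicCharacter.newton {χ : F[X] → R} (hχ : IsMonicCharacter χ) (n : ℕ) :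
    n * monicSum χ n = ∑ k ∈ Finset.Icc 1 n, primePowerSum χ k * monicSum χ (n - k) := by
  classical
  calc (n : R) * monicSum χ n
      = ∑ f ∈ monicsOfDegree F n, ∑ d ∈ Finset.Icc 1 n, ∑ m ∈ Finset.Icc 1 n,
          ∑ P ∈ primesOfDegree F d, d * (if P ^ m ∣ f then χ f else 0) := by
        rw [monicSum, Finset.mul_sum]
        refine Finset.sum_congr rfl fun f hf => ?_
        -- The factor `n` is the degree of `f`, distributed over the prime powers dividing `f`: the
        -- analogue of `log = Λ * 1`.
        conv_lhs => rw [← sum_natDegree_prime_pow_dvd hf]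
        push_cast
        simp only [Finset.sum_mul]
        refine Finset.sum_congr rfl fun d _ => Finset.sum_congr rfl fun m _ =>
          Finset.sum_congr rfl fun P _ => ?_
        split_ifs <;> simp
    _ = ∑ d ∈ Finset.Icc 1 n, ∑ m ∈ Finset.Icc 1 n, ∑ P ∈ primesOfDegree F d,
          d * (if d * m ≤ n then χ P ^ m * monicSum χ (n - d * m) else 0) := by
        rw [Finset.sum_comm]
        refine Finset.sum_congr rfl fun d _ => ?_
        rw [Finset.sum_comm]
        refine Finset.sum_congr rfl fun m _ => ?_
        rw [Finset.sum_comm]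
        refine Finset.sum_congr rfl fun P hP => ?_
        obtain ⟨⟨h1, h2⟩, -⟩ := mem_primesOfDegree.1 hP
        rw [← Finset.mul_sum, hχ.sum_dvd (h1.pow m), h1.natDegree_pow, h2, hχ.map_pow h1,
          mul_comm m d]
    _ = ∑ x ∈ (Finset.Icc 1 n ×ˢ Finset.Icc 1 n).filter (fun x => x.1 * x.2 ≤ n),
          x.1 * (∑ P ∈ primesOfDegree F x.1, χ P ^ x.2) * monicSum χ (n - x.1 * x.2) := by
        rw [Finset.sum_filter, Finset.sum_product]
        refine Finset.sum_congr rfl fun d _ => Finset.sum_congr rfl fun m _ => ?_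
        dsimp only
        split_ifs
        · rw [← Finset.mul_sum, ← Finset.sum_mul, mul_assoc]
        · simp
    _ = ∑ k ∈ Finset.Icc 1 n, ∑ x ∈ k.divisorsAntidiagonal,
          x.1 * (∑ P ∈ primesOfDegree F x.1, χ P ^ x.2) * monicSum χ (n - k) := by
        rw [Finset.sum_sigma']
        refine Finset.sum_bij' (fun x _ => ⟨x.1 * x.2, x⟩) (fun y _ => y.2) ?_ ?_ ?_ ?_ ?_
        · rintro ⟨d, m⟩ h
          simp only [Finset.mem_filter, Finset.mem_product, Finset.mem_Icc] at h
          simp only [Finset.mem_sigma, Finset.mem_Icc, Nat.mem_divisorsAntidiagonal, true_and]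
          have : 0 < d * m := Nat.mul_pos (by omega) (by omega)
          omega
        · rintro ⟨k, d, m⟩ h
          simp only [Finset.mem_sigma, Finset.mem_Icc, Nat.mem_divisorsAntidiagonal] at h
          obtain ⟨⟨h1, h2⟩, rfl, h3⟩ := h
          have hd : 0 < d := Nat.pos_of_ne_zero (by rintro rfl; simp at h3)
          have hm : 0 < m := Nat.pos_of_ne_zero (by rintro rfl; simp at h3)
          simp only [Finset.mem_filter, Finset.mem_product, Finset.mem_Icc]
          refine ⟨⟨⟨hd, ?_⟩, ⟨hm, ?_⟩⟩, h2⟩ <;> nlinarith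
        · intro x _; rfl
        · rintro ⟨k, d, m⟩ h
          simp only [Finset.mem_sigma, Finset.mem_Icc, Nat.mem_divisorsAntidiagonal] at h
          simp [h.2.1]
        · intro x _; rfl
    _ = _ := by
        refine Finset.sum_congr rfl fun k _ => ?_
        rw [← Finset.sum_mul, primePowerSum, Nat.sum_divisorsAntidiagonal
          (f := fun a b => (a : R) * ∑ P ∈ primesOfDegree F a, χ P ^ b)]

end PowerSums

/-! ### The four characters modulo 2 and their L-series -/

section Characters

/-- The nontrivial additive character of the field with two elements. -/
noncomputable def signZMod (a : ZMod 2) : ℝ := if a = 0 then 1 else -1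

@[simp] theorem signZMod_zero : signZMod 0 = 1 := by simp [signZMod]

@[simp] theorem signZMod_one : signZMod 1 = -1 := by simp [signZMod]

theorem zmod_two_cases (a : ZMod 2) : a = 0 ∨ a = 1 := by revert a; decide

theorem signZMod_add (a b : ZMod 2) : signZMod (a + b) = signZMod a * signZMod b := by
  have h : (1 : ZMod 2) + 1 = 0 := by decide
  rcases zmod_two_cases a with rfl | rfl <;> rcases zmod_two_cases b with rfl | rfl <;> simp [h]

/-- The character `f ↦ (-1) ^ (i * f_{d-1} + j * f_1)` on monic polynomials of degree `d`
prime to `X`. -/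
noncomputable def endsCharacter (i j : ℕ) (f : (ZMod 2)[X]) : ℝ :=
  if f.coeff 0 = 0 then 0 else signZMod f.nextCoeff ^ i * signZMod (f.coeff 1) ^ j

/-- The next-to-leading coefficient is additive on products of monic polynomials. The linear
coefficient of a product is `f_0 g_1 + f_1 g_0`, which is additive once both constant terms are `1`;
otherwise both sides vanish. -/
theorem isMonicCharacter_endsCharacter (i j : ℕ) : IsMonicCharacter (endsCharacter i j) where
  map_one := by simp [endsCharacter, nextCoeff, coeff_one]
  map_mul := by
    intro f g hf hg
    unfold endsCharacter
    rw [mul_coeff_zero, hf.nextCoeff_mul hg, mul_coeff_one]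
    rcases zmod_two_cases (f.coeff 0) with h | h
    · simp [h]
    rcases zmod_two_cases (g.coeff 0) with h' | h'
    · simp [h']
    simp only [h, h', signZMod_add, mul_one, one_mul, one_ne_zero, if_false]
    ring

theorem monicsOfDegree_zero {F : Type*} [Field F] [Finite F] : monicsOfDegree F 0 = {1} := by
  ext f
  simp only [mem_monicsOfDegree, Finset.mem_singleton]
  exact ⟨fun h => h.1.natDegree_eq_zero.1 h.2, by rintro rfl; simp⟩

theorem monic_X_mul_add_C {F : Type*} [Field F] {h : F[X]} (hh : h.Monic) (b : F) :
    (X * h + C b).Monic ∧ (X * h + C b).natDegree = h.natDegree + 1 := by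
  have h1 : (X * h).Monic := monic_X.mul hh
  have h2 : (X * h).natDegree = h.natDegree + 1 := natDegree_X_mul hh.ne_zero
  have h3 : (C b).degree < (X * h).degree := by
    rw [degree_eq_natDegree h1.ne_zero, h2]
    exact degree_C_le.trans_lt (by exact_mod_cast Nat.succ_pos _)
  exact ⟨h1.add_of_left h3, by rw [natDegree_add_eq_left_of_degree_lt h3, h2]⟩

/-- Sums over monic polynomials of degree `n + 1` by splitting off the constant coefficient. -/
theorem sum_monicsOfDegree_succ {F : Type*} [Field F] [Fintype F] {R : Type*} [AddCommMonoid R]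
    (n : ℕ) (φ : F[X] → R) :
    ∑ f ∈ monicsOfDegree F (n + 1), φ f =
      ∑ b : F, ∑ h ∈ monicsOfDegree F n, φ (X * h + C b) := by
  rw [← Finset.sum_product']
  symm
  refine Finset.sum_bij (fun x _ => X * x.2 + C x.1) ?_ ?_ ?_ fun _ _ => rfl
  · rintro ⟨b, h⟩ hx
    simp only [Finset.mem_product, mem_monicsOfDegree] at hx
    rw [mem_monicsOfDegree, ← hx.2.2]
    exact monic_X_mul_add_C hx.2.1 b
  · rintro ⟨b, h⟩ _ ⟨c, k⟩ _ hx
    have h0 : b = c := by simpa using congrArg (coeff · 0) hx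
    subst h0
    simpa using hx
  · intro f hf
    obtain ⟨h1, h2⟩ := mem_monicsOfDegree.1 hf
    have h3 := X_mul_divX_add f
    have hm : f.divX.Monic := by
      rw [Monic, leadingCoeff, natDegree_divX_eq_natDegree_tsub_one, coeff_divX, h2]
      simpa [Monic, leadingCoeff, h2] using h1
    refine ⟨(f.coeff 0, f.divX), ?_, h3⟩
    simp [hm, natDegree_divX_eq_natDegree_tsub_one, h2]

theorem monicSum_endsCharacter_zero (i j : ℕ) : monicSum (endsCharacter i j) 0 = 1 := by
  rw [monicSum, monicsOfDegree_zero, Finset.sum_singleton,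
    (isMonicCharacter_endsCharacter i j).map_one]

theorem monicSum_endsCharacter_succ (i j n : ℕ) :
    monicSum (endsCharacter i j) (n + 1) =
      ∑ h ∈ monicsOfDegree (ZMod 2) n,
        signZMod (X * h + 1).nextCoeff ^ i * signZMod (h.coeff 0) ^ j := by
  rw [monicSum, sum_monicsOfDegree_succ, show (Finset.univ : Finset (ZMod 2)) = {0, 1} from rfl,
    Finset.sum_insert (by decide), Finset.sum_singleton, Finset.sum_eq_zero, zero_add]
  · refine Finset.sum_congr rfl fun h _ => ?_
    simp [endsCharacter, coeff_X_mul, coeff_one]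
  · intro h _
    simp [endsCharacter]

theorem card_monicsOfDegree (n : ℕ) : (monicsOfDegree (ZMod 2) n).card = 2 ^ n := by
  induction n with
  | zero => simp [monicsOfDegree_zero]
  | succ n ih =>
    rw [Finset.card_eq_sum_ones, sum_monicsOfDegree_succ]
    simp [ih, pow_succ, mul_comm]

theorem monicSum_endsCharacter_one (i j : ℕ) :
    monicSum (endsCharacter i j) 1 = (-1) ^ i * (-1) ^ j := by
  have h1 := monicSum_endsCharacter_succ i j 0
  rw [monicsOfDegree_zero, Finset.sum_singleton, zero_add] at h1
  have : (X * 1 + 1 : (ZMod 2)[X]).nextCoeff = 1 := by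
    rw [mul_one, ← C_1, nextCoeff_X_add_C]
  rw [h1, this]
  simp

theorem nextCoeff_X_mul_add_one {F : Type*} [Field F] {h : F[X]} (hh : h.Monic)
    (hd : 0 < h.natDegree) : (X * h + 1).nextCoeff = h.nextCoeff := by
  have h2 := (monic_X_mul_add_C hh 1).2
  rw [C_1] at h2
  rw [nextCoeff_of_natDegree_pos (by omega), nextCoeff_of_natDegree_pos hd, h2]
  obtain ⟨m, hm⟩ : ∃ m, h.natDegree = m + 1 := ⟨h.natDegree - 1, by omega⟩
  simp [hm, coeff_one]

/-- In degree `2` the two prescribed coefficients are the same one, so their signs cancel and each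
of `X^2 + bX + 1` contributes `1`. -/
theorem monicSum_endsCharacter_two : monicSum (endsCharacter 1 1) 2 = 2 := by
  have h2 := monicSum_endsCharacter_succ 1 1 1
  have : ∀ h ∈ monicsOfDegree (ZMod 2) 1,
      signZMod (X * h + 1).nextCoeff ^ 1 * signZMod (h.coeff 0) ^ 1 = 1 := by
    intro h hh
    obtain ⟨h1, h2⟩ := mem_monicsOfDegree.1 hh
    rw [nextCoeff_X_mul_add_one h1 (by omega), nextCoeff_of_natDegree_pos (by omega), h2]
    rcases zmod_two_cases (h.coeff 0) with h | h <;> simp [h]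
  rw [Finset.sum_congr rfl this] at h2
  simpa [card_monicsOfDegree] using h2

/-- Adding a monomial of lower degree permutes the monic polynomials of a given degree. -/
theorem sum_monicsOfDegree_add_X_pow {m n : ℕ} (hmn : m < n) (φ : (ZMod 2)[X] → ℝ) :
    ∑ f ∈ monicsOfDegree (ZMod 2) n, φ (f + X ^ m) = ∑ f ∈ monicsOfDegree (ZMod 2) n, φ f := by
  have hmem : ∀ f ∈ monicsOfDegree (ZMod 2) n, f + X ^ m ∈ monicsOfDegree (ZMod 2) n := by
    intro f hf
    obtain ⟨h1, h2⟩ := mem_monicsOfDegree.1 hf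
    have h3 : (X ^ m : (ZMod 2)[X]).degree < f.degree := by
      rw [degree_eq_natDegree h1.ne_zero, h2, degree_X_pow]
      exact_mod_cast hmn
    exact mem_monicsOfDegree.2
      ⟨h1.add_of_left h3, by rw [natDegree_add_eq_left_of_degree_lt h3, h2]⟩
  have hinv : ∀ f : (ZMod 2)[X], f + X ^ m + X ^ m = f := fun f => by
    rw [add_assoc, CharTwo.add_self_eq_zero, add_zero]
  exact Finset.sum_bij' (fun f _ => f + X ^ m) (fun f _ => f + X ^ m) hmem hmem
    (fun f _ => hinv f) (fun f _ => hinv f) fun _ _ => rfl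

theorem monicSum_eq_zero_of_add_X_pow {m n : ℕ} (hmn : m < n) {φ : (ZMod 2)[X] → ℝ}
    (h : ∀ f ∈ monicsOfDegree (ZMod 2) n, φ (f + X ^ m) = - φ f) : monicSum φ n = 0 := by
  have h1 := sum_monicsOfDegree_add_X_pow hmn φ
  rw [Finset.sum_congr rfl h, Finset.sum_neg_distrib] at h1
  rw [monicSum]
  linarith

theorem nextCoeff_add_X_pow {m n : ℕ} (hmn : m < n) {f : (ZMod 2)[X]}
    (hf : f ∈ monicsOfDegree (ZMod 2) n) :
    (f + X ^ m).nextCoeff = f.nextCoeff + if n - 1 = m then 1 else 0 := by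
  obtain ⟨h1, h2⟩ := mem_monicsOfDegree.1 hf
  have h3 : (X ^ m : (ZMod 2)[X]).degree < f.degree := by
    rw [degree_eq_natDegree h1.ne_zero, h2, degree_X_pow]
    exact_mod_cast hmn
  have h4 : (f + X ^ m).natDegree = n := by rw [natDegree_add_eq_left_of_degree_lt h3, h2]
  rw [nextCoeff_of_natDegree_pos (by omega), nextCoeff_of_natDegree_pos (by omega), h4, h2,
    coeff_add, coeff_X_pow]

theorem monicSum_endsCharacter_one_zero {n : ℕ} (hn : 2 ≤ n) :
    monicSum (endsCharacter 1 0) n = 0 := by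
  refine monicSum_eq_zero_of_add_X_pow (m := n - 1) (by omega) fun f hf => ?_
  have h0 : (0 : ℕ) ≠ n - 1 := by omega
  simp only [endsCharacter, nextCoeff_add_X_pow (show n - 1 < n by omega) hf, coeff_add,
    coeff_X_pow, h0, if_false, add_zero, if_true, signZMod_add, signZMod_one, pow_zero, pow_one]
  split_ifs <;> ring

/-- The translation `f ↦ f + X` flips the sign of the linear coefficient. It leaves the other sign
alone either because that sign is absent (`i = 0`) or because `n - 1 ≠ 1`. -/
theorem monicSum_endsCharacter_right {i n : ℕ} (hn : 2 ≤ n) (hi : i = 0 ∨ 3 ≤ n) :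
    monicSum (endsCharacter i 1) n = 0 := by
  refine monicSum_eq_zero_of_add_X_pow (m := 1) (by omega) fun f hf => ?_
  have h1 : signZMod (f + X ^ 1).nextCoeff ^ i = signZMod f.nextCoeff ^ i := by
    rcases hi with rfl | hi
    · simp
    · rw [nextCoeff_add_X_pow (by omega) hf, if_neg (by omega), add_zero]
  rw [endsCharacter, h1]
  simp only [endsCharacter, coeff_add, coeff_X_pow, zero_ne_one, if_false, add_zero, if_true,
    signZMod_add, signZMod_one]
  split_ifs <;> ring

theorem monicSum_endsCharacter_trivial (n : ℕ) :
    monicSum (endsCharacter 0 0) (n + 1) = 2 ^ n := by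
  rw [monicSum_endsCharacter_succ]
  simp [card_monicsOfDegree]

/-- The L-series is the zeta function `1/(1 - 2T)` without its Euler factor at `X`, hence the `-1`.
In the induction, Newton's identity in one degree is compared with twice the identity in the
previous degree. -/
theorem primePowerSum_endsCharacter_trivial (k : ℕ) :
    primePowerSum (endsCharacter 0 0) (k + 1) = 2 ^ (k + 1) - 1 := by
  have hN := (isMonicCharacter_endsCharacter 0 0).newton
  set p := primePowerSum (endsCharacter 0 0)
  have h0 := monicSum_endsCharacter_zero 0 0
  have hc := monicSum_endsCharacter_trivial
  have hS : ∀ n : ℕ, ∑ k ∈ Finset.Icc 1 n, p k * monicSum (endsCharacter 0 0) (n + 1 - k) =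
      ∑ k ∈ Finset.Icc 1 n, p k * 2 ^ (n - k) := fun n =>
    Finset.sum_congr rfl fun k hk => by
      rw [← hc, Nat.sub_add_comm (Finset.mem_Icc.1 hk).2]
  have hN' : ∀ n : ℕ, ((n : ℝ) + 1) * 2 ^ n =
      ∑ k ∈ Finset.Icc 1 n, p k * 2 ^ (n - k) + p (n + 1) := fun n => by
    have := hN (n + 1)
    rw [Finset.sum_Icc_succ_top (by omega), hS, Nat.sub_self, h0, hc] at this
    push_cast at this
    linarith
  induction k with
  | zero => have := hN' 0; norm_num at this ⊢; linarith
  | succ k ih =>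
    have h1 := hN' k
    have h2 := hN' (k + 1)
    have h3 : ∑ i ∈ Finset.Icc 1 k, p i * 2 ^ (k + 1 - i) =
        2 * ∑ i ∈ Finset.Icc 1 k, p i * 2 ^ (k - i) := by
      rw [Finset.mul_sum]
      refine Finset.sum_congr rfl fun i hi => ?_
      rw [Nat.sub_add_comm (Finset.mem_Icc.1 hi).2, pow_succ]
      ring
    rw [Finset.sum_Icc_succ_top (by omega), h3, Nat.sub_self] at h2
    push_cast at h2
    rw [pow_succ] at h2 ih ⊢
    rw [pow_succ]
    linarith

theorem sum_Icc_one_eq_add_of_eq_zero {p c : ℕ → ℝ} {n : ℕ} (hc : ∀ m, 2 ≤ m → c m = 0) :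
    ∑ k ∈ Finset.Icc 1 (n + 2), p k * c (n + 2 - k) = p (n + 1) * c 1 + p (n + 2) * c 0 := by
  rw [Finset.sum_Icc_succ_top (by omega), Finset.sum_Icc_succ_top (by omega), Nat.sub_self,
    Finset.sum_eq_zero, show n + 1 + 1 - (n + 1) = 1 by omega, zero_add]
  intro k hk
  rw [hc _ (by have := (Finset.mem_Icc.1 hk).2; omega), mul_zero]

/-- The L-series is `1 - T`, whose only reciprocal root is `1`. -/
theorem primePowerSum_eq_neg_one {χ : (ZMod 2)[X] → ℝ} (hχ : IsMonicCharacter χ)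
    (h0 : monicSum χ 0 = 1) (h1 : monicSum χ 1 = -1) (h2 : ∀ m, 2 ≤ m → monicSum χ m = 0) (k : ℕ) :
    primePowerSum χ (k + 1) = -1 := by
  induction k with
  | zero =>
    have := hχ.newton 1
    simp only [Finset.Icc_self, Finset.sum_singleton, h0, h1] at this
    norm_num at this ⊢
    linarith
  | succ k ih =>
    have := hχ.newton (k + 2)
    rw [sum_Icc_one_eq_add_of_eq_zero h2, h0, h1, h2 _ (by omega), ih] at this
    rw [show k + 1 + 1 = k + 2 from rfl]
    linarith

theorem primePowerSum_endsCharacter_one_zero (k : ℕ) :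
    primePowerSum (endsCharacter 1 0) (k + 1) = -1 :=
  primePowerSum_eq_neg_one (isMonicCharacter_endsCharacter 1 0) (monicSum_endsCharacter_zero _ _)
    (by simp [monicSum_endsCharacter_one]) (fun _ => monicSum_endsCharacter_one_zero) k

theorem primePowerSum_endsCharacter_zero_one (k : ℕ) :
    primePowerSum (endsCharacter 0 1) (k + 1) = -1 :=
  primePowerSum_eq_neg_one (isMonicCharacter_endsCharacter 0 1) (monicSum_endsCharacter_zero _ _)
    (by simp [monicSum_endsCharacter_one])
    (fun _ hm => monicSum_endsCharacter_right hm (Or.inl rfl)) k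

/-- The Kloosterman sums over the extensions of the field with two elements satisfy the
recurrence given by their L-function `1 + T + 2 T ^ 2`. -/
theorem primePowerSum_endsCharacter_recurrence :
    primePowerSum (endsCharacter 1 1) 1 = 1 ∧ primePowerSum (endsCharacter 1 1) 2 = 3 ∧
    ∀ k, primePowerSum (endsCharacter 1 1) (k + 3) =
      - primePowerSum (endsCharacter 1 1) (k + 2) - 2 * primePowerSum (endsCharacter 1 1) (k + 1) := by
  have hN := (isMonicCharacter_endsCharacter 1 1).newton
  have h0 := monicSum_endsCharacter_zero 1 1
  have h1 : monicSum (endsCharacter 1 1) 1 = 1 := by simp [monicSum_endsCharacter_one]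
  have h2 := monicSum_endsCharacter_two
  have h3 : ∀ m, 3 ≤ m → monicSum (endsCharacter 1 1) m = 0 := fun m hm =>
    monicSum_endsCharacter_right (by omega) (Or.inr hm)
  set p := primePowerSum (endsCharacter 1 1)
  have hp1 : p 1 = 1 := by
    have := hN 1
    simp only [Finset.Icc_self, Finset.sum_singleton, h0, h1] at this
    norm_num [h0] at this
    linarith
  refine ⟨hp1, ?_, fun k => ?_⟩
  · have := hN 2
    rw [Finset.sum_Icc_succ_top (by omega)] at this
    norm_num [h0, h1, h2, hp1] at this
    linarith
  · have := hN (k + 3)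
    rw [Finset.sum_Icc_succ_top (by omega), Finset.sum_Icc_succ_top (by omega),
      Finset.sum_Icc_succ_top (by omega), Finset.sum_eq_zero, h3 _ (by omega), Nat.sub_self,
      show k + 2 + 1 - (k + 1 + 1) = 1 by omega, show k + 2 + 1 - (k + 1) = 2 by omega,
      h0, h1, h2] at this
    · rw [show k + 2 + 1 = k + 3 from rfl, show k + 1 + 1 = k + 2 from rfl] at this
      linarith
    · intro i hi
      rw [h3 _ (by have := (Finset.mem_Icc.1 hi).2; omega), mul_zero]

/-- The reciprocal roots of `1 + T + 2T^2` have sum `-1` and product `2`, so they are `-√2 e^(±iθ)`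
with `2√2 cos θ = 1`. The proof checks that the cosine expression satisfies the same recurrence and
initial values. -/
theorem primePowerSum_endsCharacter_one_one {θ : ℝ} (hθ : Real.cos θ = 1 / (2 * √2)) (k : ℕ) :
    primePowerSum (endsCharacter 1 1) (k + 1) =
      - ((-1) ^ (k + 1) * (2 * √2 ^ (k + 1)) * Real.cos ((k + 1 : ℕ) * θ)) := by
  obtain ⟨h1, h2, h3⟩ := primePowerSum_endsCharacter_recurrence
  have hs : √2 ^ 2 = (2 : ℝ) := Real.sq_sqrt (by norm_num)
  have hs0 : √2 ≠ (0 : ℝ) := by positivity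
  have hθ' : 2 * (√2 * Real.cos θ) = 1 := by rw [hθ]; field_simp
  induction k using Nat.twoStepInduction with
  | zero => simp [h1]; linarith
  | one =>
    have hc : √2 ^ 2 * Real.cos θ ^ 2 * 4 = 1 := by
      linear_combination (2 * √2 * Real.cos θ + 1) * hθ'
    have : ((1 + 1 : ℕ) : ℝ) * θ = 2 * θ := by norm_num
    rw [this, Real.cos_two_mul, h2]
    linear_combination hc - 2 * hs
  | more k ih1 ih2 =>
    rw [h3, ih2, ih1]
    have hc : Real.cos ((k + 2 + 1 : ℕ) * θ) =
        2 * Real.cos θ * Real.cos ((k + 1 + 1 : ℕ) * θ) - Real.cos ((k + 1 : ℕ) * θ) := by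
      have e1 : ((k + 2 + 1 : ℕ) : ℝ) * θ = ((k + 1 + 1 : ℕ) : ℝ) * θ + θ := by push_cast; ring
      have e2 : ((k + 1 : ℕ) : ℝ) * θ = ((k + 1 + 1 : ℕ) : ℝ) * θ - θ := by push_cast; ring
      rw [e1, e2, Real.cos_add, Real.cos_sub]
      ring
    rw [hc]
    generalize Real.cos ((k + 1 + 1 : ℕ) * θ) = u
    generalize Real.cos ((k + 1 : ℕ) * θ) = v
    have e : (-1 : ℝ) ^ (k + 2 + 1) = (-1) ^ (k + 1) := by ring
    have e' : (-1 : ℝ) ^ (k + 1 + 1) = - (-1) ^ (k + 1) := by ring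
    rw [e, e']
    generalize (-1 : ℝ) ^ (k + 1) = w
    rw [show √2 ^ (k + 2 + 1) = √2 ^ (k + 1) * √2 ^ 2 by ring, pow_succ √2 (k + 1)]
    generalize √2 ^ (k + 1) = z
    linear_combination (2 * w * z * √2 * u) * hθ' - 2 * w * z * v * hs

end Characters

/-! ### Möbius inversion over odd divisors -/

section OddMoebius

/-- Möbius inversion along odd divisors. -/
theorem sum_odd_divisors_moebius {G H : ℕ → ℝ}
    (h : ∀ k, 0 < k → ∑ d ∈ k.divisors with ¬ 2 ∣ k / d, G d = H k) {n : ℕ} (hn : 0 < n) :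
    ∑ j ∈ n.divisors with ¬ 2 ∣ j, (ArithmeticFunction.moebius j : ℝ) * H (n / j) = G n := by
  -- A divisor with odd quotient contains the full power of `2`. With `2^s` fixed, the relation
  -- becomes ordinary Möbius inversion on the odd numbers, a set closed under divisors.
  obtain ⟨s, m, hm, rfl⟩ := Nat.exists_eq_pow_mul_and_not_dvd hn.ne' 2 (by norm_num)
  have hcop : ∀ j, ¬ 2 ∣ j → Nat.Coprime (2 ^ s) j := fun j hj =>
    Nat.Coprime.pow_left s ((Nat.Prime.coprime_iff_not_dvd Nat.prime_two).2 hj)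
  have hs : 0 < 2 ^ s := by positivity
  have key := (ArithmeticFunction.sum_eq_iff_sum_mul_moebius_eq_on (R := ℝ)
    (f := fun i => G (2 ^ s * i)) (g := fun i => H (2 ^ s * i)) {k | ¬ 2 ∣ k}
    (fun a b hab hb ha => hb (ha.trans hab))).1 (fun k hk hk2 => ?_) m
    (Nat.pos_of_mul_pos_left hn) hm
  · rw [← key, Nat.sum_divisorsAntidiagonal
      (f := fun a b => (ArithmeticFunction.moebius a : ℝ) * H (2 ^ s * b))]
    have hset : (2 ^ s * m).divisors.filter (fun j => ¬ 2 ∣ j) = m.divisors := by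
      ext j
      simp only [Finset.mem_filter, Nat.mem_divisors]
      constructor
      · rintro ⟨⟨h1, h2⟩, h3⟩
        exact ⟨(hcop j h3).symm.dvd_of_dvd_mul_left h1, (Nat.pos_of_mul_pos_left hn).ne'⟩
      · rintro ⟨h1, h2⟩
        exact ⟨⟨h1.mul_left _, hn.ne'⟩, fun h3 => hm (h3.trans h1)⟩
    rw [hset]
    refine Finset.sum_congr rfl fun j hj => ?_
    rw [Nat.mul_div_assoc _ (Nat.dvd_of_mem_divisors hj)]
  · rw [← h _ (Nat.mul_pos hs hk)]
    refine Finset.sum_bij (fun i _ => 2 ^ s * i) ?_ ?_ ?_ fun _ _ => rfl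
    · intro i hi
      obtain ⟨⟨q, rfl⟩, h2⟩ := Nat.mem_divisors.1 hi
      have hi0 : 0 < i := Nat.pos_of_mul_pos_right hk
      rw [Finset.mem_filter, Nat.mem_divisors, Nat.mul_div_mul_left _ _ hs,
        Nat.mul_div_cancel_left _ hi0]
      exact ⟨⟨mul_dvd_mul_left _ (dvd_mul_right _ _), (Nat.mul_pos hs hk).ne'⟩,
        fun h3 => hk2 (h3.mul_left _)⟩
    · intro i _ i' _ hii
      exact Nat.eq_of_mul_eq_mul_left hs hii
    · intro d hd
      obtain ⟨hd, h2⟩ := Finset.mem_filter.1 hd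
      obtain ⟨h3, -⟩ := Nat.mem_divisors.1 hd
      have h4 : 2 ^ s ∣ d := by
        refine (hcop _ h2).dvd_of_dvd_mul_right ?_
        rw [Nat.mul_div_cancel' h3]
        exact dvd_mul_right _ _
      obtain ⟨i, rfl⟩ := h4
      exact ⟨i, Nat.mem_divisors.2 ⟨Nat.dvd_of_mul_dvd_mul_left hs h3, hk.ne'⟩, rfl⟩

end OddMoebius

/-! ### Counting irreducibles with prescribed trace and reciprocal trace -/

section Count

/-- The monic irreducible polynomials of degree `n`, other than `X`, with trace `a` such that the
reciprocals of the roots have trace `1`. -/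
noncomputable def tracePrimes (n : ℕ) (a : ZMod 2) : Finset (ZMod 2)[X] :=
  (primesOfDegree (ZMod 2) n).filter fun g => g.coeff 0 ≠ 0 ∧ g.nextCoeff = a ∧ g.coeff 1 = 1

theorem signZMod_sq (a : ZMod 2) : signZMod a ^ 2 = 1 := by
  rcases zmod_two_cases a with rfl | rfl <;> simp

theorem signZMod_pow_odd (a : ZMod 2) {m : ℕ} (hm : ¬ 2 ∣ m) : signZMod a ^ m = signZMod a := by
  obtain ⟨k, rfl⟩ : Odd m := Nat.not_even_iff_odd.1 fun h => hm h.two_dvd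
  rw [pow_succ, pow_mul, signZMod_sq, one_pow, one_mul]

/-- For odd `m` and `P_0 ≠ 0` the left side factors as `(1 + ε(a) ε(tr)) (1 - ε(P_1))`, where `ε` is
`signZMod` and `tr` is `P.nextCoeff`. For even `m` all signs become `1` and the four terms cancel.
-/
theorem endsCharacter_combination (a : ZMod 2) {m : ℕ} (hm : 0 < m) (P : (ZMod 2)[X]) :
    endsCharacter 0 0 P ^ m + signZMod a * endsCharacter 1 0 P ^ m - endsCharacter 0 1 P ^ m
      - signZMod a * endsCharacter 1 1 P ^ m =
    if ¬ 2 ∣ m ∧ P.coeff 0 ≠ 0 ∧ P.nextCoeff = a ∧ P.coeff 1 = 1 then 4 else 0 := by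
  by_cases h0 : P.coeff 0 = 0
  · simp [endsCharacter, h0, hm.ne']
  by_cases h2 : 2 ∣ m
  · obtain ⟨k, rfl⟩ := h2
    simp only [endsCharacter, h0, if_false, mul_pow, ← pow_mul]
    simp [mul_comm _ (2 * k), pow_mul, signZMod_sq]
  · simp only [endsCharacter, h0, if_false, mul_pow, ← pow_mul, one_mul,
      signZMod_pow_odd _ h2, pow_zero]
    rcases zmod_two_cases a with rfl | rfl <;>
      rcases zmod_two_cases P.nextCoeff with h3 | h3 <;>
      rcases zmod_two_cases (P.coeff 1) with h4 | h4 <;> simp [h0, h3, h4, h2] <;> norm_num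

theorem sum_card_tracePrimes (a : ZMod 2) (k : ℕ) :
    ∑ d ∈ k.divisors with ¬ 2 ∣ k / d, (d : ℝ) * (tracePrimes d a).card =
      (primePowerSum (endsCharacter 0 0) k + signZMod a * primePowerSum (endsCharacter 1 0) k
        - primePowerSum (endsCharacter 0 1) k
        - signZMod a * primePowerSum (endsCharacter 1 1) k) / 4 := by
  rw [eq_div_iff (by norm_num)]
  simp only [primePowerSum]
  rw [Finset.mul_sum, Finset.mul_sum, ← Finset.sum_add_distrib, ← Finset.sum_sub_distrib,
    ← Finset.sum_sub_distrib, Finset.sum_filter, Finset.sum_mul]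
  refine Finset.sum_congr rfl fun d hd => ?_
  have hm : 0 < k / d := Nat.div_pos (Nat.divisor_le hd) (Nat.pos_of_mem_divisors hd)
  have key := Finset.sum_congr (rfl : primesOfDegree (ZMod 2) d = _)
    fun P _ => endsCharacter_combination a hm P
  simp only [Finset.sum_sub_distrib, Finset.sum_add_distrib, ← Finset.mul_sum] at key
  have hcard : (if ¬ 2 ∣ k / d then (d : ℝ) * (tracePrimes d a).card else 0) * 4 =
      d * ∑ P ∈ primesOfDegree (ZMod 2) d,
        if ¬ 2 ∣ k / d ∧ P.coeff 0 ≠ 0 ∧ P.nextCoeff = a ∧ P.coeff 1 = 1 then (4 : ℝ) else 0 := by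
    by_cases h : 2 ∣ k / d
    · simp [h]
    · simp only [h, not_false_eq_true, true_and, if_true]
      rw [← Finset.sum_filter, Finset.sum_const, tracePrimes, nsmul_eq_mul]
      ring
  rw [hcard, ← key]
  ring

theorem card_tracePrimes {θ : ℝ} (hθ : Real.cos θ = 1 / (2 * √2)) (a : ZMod 2) {n : ℕ}
    (hn : 0 < n) :
    (n : ℝ) * (tracePrimes n a).card =
      ∑ j ∈ n.divisors with ¬ 2 ∣ j, (ArithmeticFunction.moebius j : ℝ) *
        ((2 ^ (n / j) - signZMod a + signZMod a *
          ((-1) ^ (n / j) * (2 * √2 ^ (n / j)) * Real.cos ((n / j : ℕ) * θ))) / 4) := by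
  refine (sum_odd_divisors_moebius (G := fun n => (n : ℝ) * (tracePrimes n a).card)
    (H := fun k => (2 ^ k - signZMod a + signZMod a *
          ((-1) ^ k * (2 * √2 ^ k) * Real.cos (k * θ))) / 4) (fun k hk => ?_) hn).symm
  obtain ⟨k, rfl⟩ := Nat.exists_eq_succ_of_ne_zero hk.ne'
  rw [sum_card_tracePrimes a, Nat.succ_eq_add_one, primePowerSum_endsCharacter_trivial,
    primePowerSum_endsCharacter_one_zero, primePowerSum_endsCharacter_zero_one,
    primePowerSum_endsCharacter_one_one hθ]
  ring

end Count

/-! ### The substitution `g ↦ x^n g(x + 1/x)` -/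

section ReciprocalLift

variable {F : Type*} [Field F]

/-- The polynomial `x ^ n * g (x + 1 / x)`, for `g` of degree at most `n`. -/
noncomputable def reciprocalLift (n : ℕ) (g : F[X]) : F[X] :=
  ∑ i ∈ Finset.range (n + 1), C (g.coeff i) * X ^ (n - i) * (X ^ 2 + 1) ^ i

theorem reciprocalLift_zero (g : F[X]) : reciprocalLift 0 g = C (g.coeff 0) := by
  simp [reciprocalLift]

theorem reciprocalLift_succ (n : ℕ) (g : F[X]) :
    reciprocalLift (n + 1) g =
      X * reciprocalLift n g + C (g.coeff (n + 1)) * (X ^ 2 + 1) ^ (n + 1) := by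
  rw [reciprocalLift, Finset.sum_range_succ, Nat.sub_self, pow_zero, mul_one, reciprocalLift,
    Finset.mul_sum]
  congr 1
  refine Finset.sum_congr rfl fun i hi => ?_
  rw [Nat.sub_add_comm (Nat.lt_succ_iff.1 (Finset.mem_range.1 hi)), pow_succ]
  ring

theorem reciprocalLift_congr {n : ℕ} {g h : F[X]} (H : ∀ i ≤ n, g.coeff i = h.coeff i) :
    reciprocalLift n g = reciprocalLift n h :=
  Finset.sum_congr rfl fun i hi => by rw [H i (Nat.lt_succ_iff.1 (Finset.mem_range.1 hi))]

theorem aeval_reciprocalLift {L : Type*} [Field L] [Algebra F L] {β : L} (hβ : β ≠ 0) {n : ℕ}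
    {g : F[X]} (hg : g.natDegree ≤ n) :
    aeval β (reciprocalLift n g) = β ^ n * aeval (β + β⁻¹) g := by
  rw [aeval_eq_sum_range' (Nat.lt_succ_iff.2 hg), reciprocalLift, map_sum, Finset.mul_sum]
  refine Finset.sum_congr rfl fun i hi => ?_
  have hi' := Nat.lt_succ_iff.1 (Finset.mem_range.1 hi)
  have h1 : β + β⁻¹ = (β ^ 2 + 1) / β := by field_simp
  rw [h1, Algebra.smul_def, div_pow, ← Nat.sub_add_cancel hi', pow_add, Nat.add_sub_cancel]
  simp only [map_mul, map_pow, map_add, aeval_X, aeval_C, map_one]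
  field_simp

/-- In the field of rational functions the lift really is `X^n g(X + 1/X)`, which is visibly
multiplicative. -/
theorem reciprocalLift_mul {m n : ℕ} {g h : F[X]} (hg : g.natDegree ≤ m) (hh : h.natDegree ≤ n) :
    reciprocalLift (m + n) (g * h) = reciprocalLift m g * reciprocalLift n h := by
  apply RatFunc.algebraMap_injective F
  have hX : (RatFunc.X : RatFunc F) ≠ 0 := RatFunc.X_ne_zero
  rw [map_mul, ← RatFunc.aeval_X_left_eq_algebraMap, ← RatFunc.aeval_X_left_eq_algebraMap,
    ← RatFunc.aeval_X_left_eq_algebraMap, aeval_reciprocalLift hX hg, aeval_reciprocalLift hX hh,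
    aeval_reciprocalLift hX (natDegree_mul_le.trans (add_le_add hg hh)), map_mul, pow_add]
  ring

theorem monic_X_sq_add_one_pow (m : ℕ) : ((X ^ 2 + 1 : F[X]) ^ m).Monic := by
  have : (X ^ 2 + 1 : F[X]).Monic := by simpa using monic_X_pow_add_C (1 : F) two_ne_zero
  exact this.pow m

theorem natDegree_X_sq_add_one_pow (m : ℕ) : ((X ^ 2 + 1 : F[X]) ^ m).natDegree = 2 * m := by
  rw [natDegree_pow, ← C_1, natDegree_X_pow_add_C, mul_comm]

theorem coeff_X_sq_add_one_pow_odd (m k : ℕ) : ((X ^ 2 + 1 : F[X]) ^ m).coeff (2 * k + 1) = 0 := by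
  have : (X ^ 2 + 1 : F[X]) ^ m = expand F 2 ((X + 1) ^ m) := by simp
  rw [this, coeff_expand (by norm_num), if_neg (by omega)]

theorem reflect_X_sq_add_one_pow (m : ℕ) :
    reflect (2 * m) ((X ^ 2 + 1 : F[X]) ^ m) = (X ^ 2 + 1) ^ m := by
  induction m with
  | zero => simp
  | succ m ih =>
    have h2 : reflect 2 (X ^ 2 + 1 : F[X]) = X ^ 2 + 1 := by
      rw [reflect_add, reflect_monomial, reflect_one, revAt_le le_rfl, Nat.sub_self, pow_zero,
        add_comm]
    rw [pow_succ, Nat.mul_succ, reflect_mul _ _ (natDegree_X_sq_add_one_pow m).le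
      (by simpa using (natDegree_X_sq_add_one_pow (F := F) 1).le), ih, h2]

theorem reflect_X_mul {q : F[X]} {n : ℕ} (hq : q.natDegree ≤ 2 * n) :
    reflect (2 * (n + 1)) (X * q) = X * reflect (2 * n) q := by
  rw [show 2 * (n + 1) = 2 + 2 * n by ring, reflect_mul _ _ (natDegree_X_le.trans one_le_two) hq]
  congr 1
  have := reflect_monomial (R := F) 2 1
  rw [pow_one, revAt_le one_le_two] at this
  simpa using this

theorem natDegree_reciprocalLift_le (n : ℕ) (g : F[X]) :
    (reciprocalLift n g).natDegree ≤ 2 * n := by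
  induction n with
  | zero => simp [reciprocalLift_zero]
  | succ n ih =>
    rw [reciprocalLift_succ]
    refine natDegree_add_le_of_degree_le (natDegree_mul_le.trans ?_)
      ((natDegree_C_mul_le _ _).trans (natDegree_X_sq_add_one_pow _).le)
    have := natDegree_X_le (R := F)
    omega

theorem coeff_two_mul_reciprocalLift (n : ℕ) (g : F[X]) :
    (reciprocalLift n g).coeff (2 * n) = g.coeff n := by
  cases n with
  | zero => simp [reciprocalLift_zero]
  | succ n =>
    have h1 := monic_X_sq_add_one_pow (F := F) (n + 1)
    rw [Monic, leadingCoeff, natDegree_X_sq_add_one_pow] at h1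
    rw [reciprocalLift_succ, coeff_add, coeff_C_mul, h1, mul_one,
      show 2 * (n + 1) = 2 * n + 1 + 1 by ring, coeff_X_mul, coeff_eq_zero_of_natDegree_lt, zero_add]
    exact Nat.lt_succ_of_le (natDegree_reciprocalLift_le n g)

/-- The top term is a multiple of a power of `X^2 + 1`, hence even in `X`, and contributes nothing
in odd degree. -/
theorem coeff_sub_one_reciprocalLift (n : ℕ) (g : F[X]) :
    (reciprocalLift (n + 1) g).coeff (2 * n + 1) = g.coeff n := by
  rw [reciprocalLift_succ, coeff_add, coeff_C_mul, coeff_X_sq_add_one_pow_odd, mul_zero, add_zero,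
    coeff_X_mul, coeff_two_mul_reciprocalLift]

theorem reflect_reciprocalLift (n : ℕ) (g : F[X]) :
    reflect (2 * n) (reciprocalLift n g) = reciprocalLift n g := by
  induction n with
  | zero => simp [reciprocalLift_zero]
  | succ n ih =>
    rw [reciprocalLift_succ, reflect_add, reflect_C_mul, reflect_X_sq_add_one_pow,
      reflect_X_mul (natDegree_reciprocalLift_le n g), ih]

theorem coeff_eq_of_reciprocalLift_eq {n : ℕ} {g h : F[X]}
    (H : reciprocalLift n g = reciprocalLift n h) : ∀ i ≤ n, g.coeff i = h.coeff i := by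
  induction n with
  | zero =>
    intro i hi
    obtain rfl : i = 0 := by omega
    simpa [reciprocalLift_zero] using H
  | succ n ih =>
    have h1 : g.coeff (n + 1) = h.coeff (n + 1) := by
      rw [← coeff_two_mul_reciprocalLift, H, coeff_two_mul_reciprocalLift]
    rw [reciprocalLift_succ, reciprocalLift_succ, h1, add_left_inj] at H
    intro i hi
    rcases Nat.lt_or_eq_of_le hi with hi | rfl
    · exact ih (mul_left_cancel₀ X_ne_zero H) i (by omega)
    · exact h1

theorem exists_reciprocalLift_eq {n : ℕ} {f : F[X]} (hf : f.natDegree ≤ 2 * n)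
    (hr : reflect (2 * n) f = f) : ∃ g : F[X], g.natDegree ≤ n ∧ reciprocalLift n g = f := by
  induction n generalizing f with
  | zero =>
    refine ⟨f, by simpa using hf, ?_⟩
    rw [reciprocalLift_zero, ← eq_C_of_natDegree_le_zero (by simpa using hf)]
  | succ n ih =>
    set b := f.coeff (2 * (n + 1)) with hb
    set q := f - C b * (X ^ 2 + 1) ^ (n + 1) with hq
    have hqr : reflect (2 * (n + 1)) q = q := by
      rw [hq, reflect_sub, hr, reflect_C_mul, reflect_X_sq_add_one_pow]
    have hqtop : q.coeff (2 * (n + 1)) = 0 := by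
      have h1 := monic_X_sq_add_one_pow (F := F) (n + 1)
      rw [Monic, leadingCoeff, natDegree_X_sq_add_one_pow] at h1
      rw [hq, coeff_sub, coeff_C_mul, h1, mul_one, sub_self]
    -- Removing the top coefficient also removes the constant one, by symmetry. So `q` is divisible
    -- by `X`, and the quotient is symmetric about degree `n`.
    have hq0 : q.coeff 0 = 0 := by
      rw [← hqr, coeff_reflect, revAt_zero, hqtop]
    have hqX : X * q.divX = q := by
      have := X_mul_divX_add q
      rwa [hq0, C_0, add_zero] at this
    have hqd : q.natDegree ≤ 2 * (n + 1) :=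
      (natDegree_sub_le _ _).trans (max_le hf ((natDegree_C_mul_le _ _).trans
        (natDegree_X_sq_add_one_pow _).le))
    have hqd' : q.natDegree ≤ 2 * n + 1 := by
      by_contra hlt
      have h2 : q.natDegree = 2 * (n + 1) := by omega
      have h3 : q.leadingCoeff = 0 := by rw [leadingCoeff, h2, hqtop]
      rw [leadingCoeff_eq_zero.1 h3] at h2
      simp at h2
    have hdd : q.divX.natDegree ≤ 2 * n := by
      rw [natDegree_divX_eq_natDegree_tsub_one]; omega
    obtain ⟨g, hg, hgl⟩ := ih hdd (by
      rw [← hqX, reflect_X_mul hdd] at hqr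
      exact mul_left_cancel₀ X_ne_zero hqr)
    refine ⟨g + C b * X ^ (n + 1), ?_, ?_⟩
    · exact natDegree_add_le_of_degree_le (by omega) (natDegree_C_mul_X_pow_le _ _)
    · have h1 : reciprocalLift n (g + C b * X ^ (n + 1)) = reciprocalLift n g :=
        reciprocalLift_congr fun i hi => by
          rw [coeff_add, coeff_C_mul_X_pow, if_neg (by omega), add_zero]
      rw [reciprocalLift_succ, h1, hgl, hqX, coeff_add, coeff_C_mul_X_pow, if_pos rfl,
        coeff_eq_zero_of_natDegree_lt (Nat.lt_succ_of_le hg), zero_add, hq, sub_add_cancel]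

theorem monic_reciprocalLift {n : ℕ} {g : F[X]} (hg : g.Monic) (hn : g.natDegree = n) :
    (reciprocalLift n g).Monic ∧ (reciprocalLift n g).natDegree = 2 * n := by
  have h1 : (reciprocalLift n g).coeff (2 * n) = 1 := by
    rw [coeff_two_mul_reciprocalLift, ← hn]; exact hg
  have h2 : (reciprocalLift n g).natDegree = 2 * n :=
    le_antisymm (natDegree_reciprocalLift_le n g) (le_natDegree_of_ne_zero (by simp [h1]))
  exact ⟨by rw [Monic, leadingCoeff, h2, h1], h2⟩

theorem irreducible_of_irreducible_reciprocalLift {n : ℕ} (hn : 0 < n) {g : F[X]} (hg : g.Monic)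
    (hd : g.natDegree = n) (h : Irreducible (reciprocalLift n g)) : Irreducible g := by
  have hg1 : g ≠ 1 := by rintro rfl; simp at hd; omega
  refine (irreducible_of_monic hg hg1).2 fun u v hu hv huv => ?_
  have hsum : u.natDegree + v.natDegree = n := by rw [← hu.natDegree_mul hv, huv, hd]
  have hdeg : ∀ w : F[X], w.Monic → IsUnit (reciprocalLift w.natDegree w) → w = 1 := by
    intro w hw hu
    have := natDegree_eq_zero_of_isUnit hu
    rw [(monic_reciprocalLift hw rfl).2] at this
    exact hw.natDegree_eq_zero.1 (by omega)
  rw [← huv, ← hsum, reciprocalLift_mul le_rfl le_rfl] at h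
  exact (h.isUnit_or_isUnit rfl).imp (hdeg u hu) (hdeg v hv)

end ReciprocalLift

/-! ### Traces, Artin–Schreier equations and inverses -/

section Trace

theorem trace_sq {L : Type*} [Field L] [Algebra (ZMod 2) L] [FiniteDimensional (ZMod 2) L] (u : L) :
    Algebra.trace (ZMod 2) L (u ^ 2) = Algebra.trace (ZMod 2) L u := by
  have h := Algebra.trace_eq_of_algEquiv (FiniteField.frobeniusAlgEquivOfAlgebraic (ZMod 2) L) u
  rwa [FiniteField.coe_frobeniusAlgEquivOfAlgebraic, ZMod.card] at h

/-- Additive Hilbert 90 for finite fields of characteristic two. -/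
theorem exists_sq_add_self_eq_of_trace_eq_zero {L : Type*} [Field L] [Algebra (ZMod 2) L]
    [FiniteDimensional (ZMod 2) L] {x : L} (hx : Algebra.trace (ZMod 2) L x = 0) :
    ∃ u : L, u ^ 2 + u = x := by
  have : CharP L 2 := charP_of_injective_algebraMap (algebraMap (ZMod 2) L).injective 2
  have : Finite L := Module.finite_of_finite (ZMod 2)
  let φ : L →ₗ[ZMod 2] L :=
    (FiniteField.frobeniusAlgHom (ZMod 2) L).toLinearMap + LinearMap.id
  have hφ : ∀ u, φ u = u ^ 2 + u := fun u => by
    simp [φ, ZMod.card]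
  have hker : LinearMap.ker φ = Submodule.span (ZMod 2) {1} := by
    ext u
    rw [LinearMap.mem_ker, hφ, Submodule.mem_span_singleton]
    constructor
    · intro hu
      have : u * (u + 1) = 0 := by linear_combination hu
      rcases mul_eq_zero.1 this with h | h
      · exact ⟨0, by simp [h]⟩
      · exact ⟨1, by rw [one_smul, CharTwo.add_eq_zero.1 h]⟩
    · rintro ⟨a, rfl⟩
      rcases zmod_two_cases a with rfl | rfl
      · simp
      · simp [CharTwo.add_self_eq_zero]
  have hle : LinearMap.range φ ≤ LinearMap.ker (Algebra.trace (ZMod 2) L) := by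
    rintro _ ⟨u, rfl⟩
    rw [LinearMap.mem_ker, hφ, map_add, trace_sq, CharTwo.add_self_eq_zero]
  -- The kernel of `φ` is the prime field, so its range has codimension one, just like the trace
  -- kernel containing it; the two are equal.
  have h1 := LinearMap.finrank_range_add_finrank_ker φ
  have h2 := LinearMap.finrank_range_add_finrank_ker (Algebra.trace (ZMod 2) L)
  rw [hker, finrank_span_singleton one_ne_zero] at h1
  rw [LinearMap.range_eq_top.2 (Algebra.trace_surjective (ZMod 2) L), finrank_top,
    Module.finrank_self] at h2
  have heq := Submodule.eq_of_le_of_finrank_eq hle (by omega)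
  obtain ⟨u, hu⟩ : x ∈ LinearMap.range φ := by rw [heq]; exact hx
  exact ⟨u, by rw [← hφ, hu]⟩

open IntermediateField in
/-- The trace of the inverse of a generator, in terms of its minimal polynomial. -/
theorem trace_inv_eq_neg_coeff_one {K L : Type*} [Field K] [Field L] [Algebra K L]
    [FiniteDimensional K L] {g : K[X]} (hm : g.Monic) (hg : Irreducible g) {α : L}
    (hα : aeval α g = 0) (hd : g.natDegree = Module.finrank K L) (h0 : g.coeff 0 = 1) :
    Algebra.trace K L α⁻¹ = - g.coeff 1 := by
  have hα0 : α ≠ 0 := by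
    rintro rfl
    rw [← coeff_zero_eq_aeval_zero', h0, map_one] at hα
    exact one_ne_zero hα
  have hmin : minpoly K α = g := (minpoly.eq_of_irreducible_of_monic hg hα hm).symm
  have htop : K⟮α⟯ = ⊤ := (Field.primitive_element_iff_minpoly_natDegree_eq K α).2 (by rw [hmin, hd])
  have htop' : K⟮α⁻¹⟯ = ⊤ := by
    rw [eq_top_iff, ← htop, adjoin_simple_le_iff]
    simpa using inv_mem (mem_adjoin_simple_self K α⁻¹)
  have hdeg := (Field.primitive_element_iff_minpoly_natDegree_eq K α⁻¹).1 htop'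
  have hrd : g.reverse.natDegree = g.natDegree := by
    rw [reverse_natDegree, natTrailingDegree_eq_zero.2 (Or.inr (by simp [h0])), Nat.sub_zero]
  have hrm : g.reverse.Monic := by
    rw [Monic, leadingCoeff, hrd, coeff_reverse, revAt_le le_rfl, Nat.sub_self, h0]
  have hra : aeval α⁻¹ g.reverse = 0 := by
    have : Invertible α := invertibleOfNonzero hα0
    have h := (eval₂_reverse_eq_zero_iff (algebraMap K L) α g).2 hα
    rwa [invOf_eq_inv] at h
  -- `g.reverse` is monic because `g_0 = 1`, vanishes at `α⁻¹`, and has the degree of this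
  -- generator. Its next-to-leading coefficient is `g_1`.
  have hmin' : minpoly K α⁻¹ = g.reverse :=
    (eq_of_monic_of_dvd_of_natDegree_le (minpoly.monic (.of_finite K _)) hrm (minpoly.dvd K _ hra)
      (by rw [hrd, hd, hdeg])).symm
  have hpos : 0 < g.natDegree := hg.natDegree_pos
  rw [trace_eq_finrank_mul_minpoly_nextCoeff, htop', IntermediateField.finrank_top, hmin',
    Nat.cast_one, one_mul,
    nextCoeff_of_natDegree_pos (by omega), hrd, coeff_reverse, revAt_le (by omega),
    Nat.sub_sub_self hpos]

end Trace

/-! ### Irreducibility of the lift and the bijection -/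

section Irreducibility

/-- If `g_0 = 0`, then `1` is a root of the lift, since `1 + 1 = 0`. If `g_1 = 0`, then `1/α` has
trace zero, so the lift of degree `2n` acquires a root in the field `F_2(α)` of degree `n`. -/
theorem coeff_one_of_irreducible_reciprocalLift {n : ℕ} (hn : 0 < n) {g : (ZMod 2)[X]}
    (hg : g.Monic) (hd : g.natDegree = n) (h : Irreducible (reciprocalLift n g)) :
    g.coeff 0 = 1 ∧ g.coeff 1 = 1 := by
  have hgi := irreducible_of_irreducible_reciprocalLift hn hg hd h
  obtain ⟨hQm, hQd⟩ := monic_reciprocalLift hg hd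
  have h0 : g.coeff 0 = 1 := by
    refine (zmod_two_cases _).resolve_left fun h0 => ?_
    have hroot : (reciprocalLift n g).IsRoot 1 := by
      have h1 := aeval_reciprocalLift (one_ne_zero (α := ZMod 2)) hd.le
      rw [inv_one, CharTwo.add_self_eq_zero, ← coeff_zero_eq_aeval_zero, h0, mul_zero] at h1
      simpa using h1
    have := natDegree_eq_of_degree_eq_some (n := 1) (degree_eq_one_of_irreducible_of_root h hroot)
    rw [hQd] at this
    omega
  refine ⟨h0, (zmod_two_cases _).resolve_left fun h1 => ?_⟩
  have : Fact (Irreducible g) := ⟨hgi⟩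
  have : FiniteDimensional (ZMod 2) (AdjoinRoot g) := (AdjoinRoot.powerBasis hg.ne_zero).finite
  have : CharP (AdjoinRoot g) 2 :=
    charP_of_injective_algebraMap (algebraMap (ZMod 2) (AdjoinRoot g)).injective 2
  have hfr : Module.finrank (ZMod 2) (AdjoinRoot g) = n := by
    rw [(AdjoinRoot.powerBasis hg.ne_zero).finrank, AdjoinRoot.powerBasis_dim, hd]
  set α := AdjoinRoot.root g
  have hα : aeval α g = 0 := by rw [AdjoinRoot.aeval_eq, AdjoinRoot.mk_self]
  have hα0 : α ≠ 0 := by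
    intro h
    rw [h, ← coeff_zero_eq_aeval_zero', h0, map_one] at hα
    exact one_ne_zero hα
  have htr := trace_inv_eq_neg_coeff_one hg hgi hα (by rw [hd, hfr]) h0
  rw [h1, neg_zero] at htr
  obtain ⟨u, hu⟩ := exists_sq_add_self_eq_of_trace_eq_zero htr
  have huu : u * (u + 1) = α⁻¹ := by rw [← hu]; ring
  have hne : u * (u + 1) ≠ 0 := by rw [huu]; exact inv_ne_zero hα0
  have hu0 : u ≠ 0 := left_ne_zero_of_mul hne
  have hu1 : u + 1 ≠ 0 := right_ne_zero_of_mul hne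
  -- The root is `β = 1 + 1/u`: then `β + 1/β = (β + 1)^2 / β = 1/(u^2 + u) = α`.
  have hβ : 1 + u⁻¹ = (u + 1) / u := by field_simp
  have hβ0 : 1 + u⁻¹ ≠ 0 := by rw [hβ]; exact div_ne_zero hu1 hu0
  have hβα : (1 + u⁻¹) + (1 + u⁻¹)⁻¹ = α := by
    rw [← inv_inv α, ← huu, hβ]
    field_simp
    have h2 : (2 : AdjoinRoot g) = 0 := CharTwo.two_eq_zero
    linear_combination (u ^ 2 + u) * h2
  have hroot := aeval_reciprocalLift hβ0 hd.le
  rw [hβα, hα, mul_zero] at hroot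
  have hle := minpoly.natDegree_le (A := ZMod 2) (1 + u⁻¹)
  rw [← minpoly.eq_of_irreducible_of_monic h hroot hQm, hQd, hfr] at hle
  omega

theorem irreducible_reciprocalLift {n : ℕ} {g : (ZMod 2)[X]} (hg : g.Monic)
    (hd : g.natDegree = n) (hgi : Irreducible g) (h0 : g.coeff 0 = 1) (h1 : g.coeff 1 = 1) :
    Irreducible (reciprocalLift n g) := by
  have hn : 0 < n := hd ▸ hgi.natDegree_pos
  obtain ⟨hQm, hQd⟩ := monic_reciprocalLift hg hd
  have hQ1 : reciprocalLift n g ≠ 1 := by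
    intro h
    rw [h, natDegree_one] at hQd
    omega
  by_contra hred
  rw [hQm.irreducible_iff_lt_natDegree_lt hQ1] at hred
  push Not at hred
  obtain ⟨q, hqm, hqd, hqdvd⟩ := hred
  rw [hQd, Finset.mem_Ioc] at hqd
  -- A reducible lift has an irreducible factor of degree at most half of `2n`, hence a root `β` in
  -- a field of degree at most `n`.
  obtain ⟨p, hpi, hpq⟩ := exists_irreducible_of_natDegree_pos hqd.1
  have hpd : p.natDegree ≤ n := (natDegree_le_of_dvd hpq hqm.ne_zero).trans (by omega)
  have : Fact (Irreducible p) := ⟨hpi⟩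
  have : FiniteDimensional (ZMod 2) (AdjoinRoot p) := (AdjoinRoot.powerBasis hpi.ne_zero).finite
  have : CharP (AdjoinRoot p) 2 :=
    charP_of_injective_algebraMap (algebraMap (ZMod 2) (AdjoinRoot p)).injective 2
  have hfr : Module.finrank (ZMod 2) (AdjoinRoot p) = p.natDegree := by
    rw [(AdjoinRoot.powerBasis hpi.ne_zero).finrank, AdjoinRoot.powerBasis_dim]
  set β := AdjoinRoot.root p
  have hβ : aeval β (reciprocalLift n g) = 0 := by
    rw [AdjoinRoot.aeval_eq, AdjoinRoot.mk_eq_zero]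
    exact hpq.trans hqdvd
  have hβ0 : β ≠ 0 := by
    intro h
    rw [h, ← coeff_zero_eq_aeval_zero', ← reflect_reciprocalLift, coeff_reflect, revAt_zero,
      coeff_two_mul_reciprocalLift, ← hd, show g.coeff g.natDegree = 1 from hg, map_one] at hβ
    exact one_ne_zero hβ
  have hα : aeval (β + β⁻¹) g = 0 := by
    rw [aeval_reciprocalLift hβ0 hd.le] at hβ
    exact (mul_eq_zero.1 hβ).resolve_left (pow_ne_zero _ hβ0)
  -- `β + 1/β` is a root of `g`, so it already has degree `n`. The field therefore has degree
  -- exactly `n`, and the trace of the inverse is `g_1 = 1`. But `u = 1/(β + 1)` lies in the field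
  -- and writes that inverse as `u^2 + u`, which has trace zero.
  have hle := minpoly.natDegree_le (A := ZMod 2) (β + β⁻¹)
  rw [← minpoly.eq_of_irreducible_of_monic hgi hα hg, hfr] at hle
  have htr := trace_inv_eq_neg_coeff_one hg hgi hα (by omega) h0
  have hβ1 : β + 1 ≠ 0 := by
    intro h
    rw [CharTwo.add_eq_zero.1 h, inv_one, CharTwo.add_self_eq_zero, ← coeff_zero_eq_aeval_zero', h0,
      map_one] at hα
    exact one_ne_zero hα
  have h2 : (2 : AdjoinRoot p) = 0 := CharTwo.two_eq_zero
  have hsq : (β + β⁻¹)⁻¹ = ((β + 1)⁻¹) ^ 2 + (β + 1)⁻¹ := by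
    have e : β + β⁻¹ = (β + 1) ^ 2 / β := by
      field_simp
      linear_combination (-β) * h2
    rw [e]
    field_simp
    linear_combination (-1 : AdjoinRoot p) * h2
  rw [hsq, map_add, trace_sq, CharTwo.add_self_eq_zero, h1] at htr
  exact absurd htr (by decide)

theorem mem_selfRecipIrredLead_iff {F : Type*} [Field F] {d : ℕ} (hd : 0 < d) {a : F} {f : F[X]} :
    f ∈ selfRecipIrredLead F d ![a] ↔ f ∈ selfRecipIrred F d ∧ f.coeff (d - 1) = a := by
  refine and_congr_right fun _ => ⟨fun h => ?_, fun h i => ?_⟩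
  · have h0 := h 0
    have h1 : ((0 : Fin 1) : ℕ) + 1 ≤ d := hd
    rwa [if_pos h1] at h0
  · obtain rfl : i = 0 := Subsingleton.elim (α := Fin 1) _ _
    have h1 : ((0 : Fin 1) : ℕ) + 1 ≤ d := hd
    rw [if_pos h1]
    exact h

theorem selfRecipIrredLead_eq_image {n : ℕ} (hn : 0 < n) (a : ZMod 2) :
    selfRecipIrredLead (ZMod 2) (2 * n) ![a] =
      reciprocalLift n '' (tracePrimes n a : Set (ZMod 2)[X]) := by
  obtain ⟨m, rfl⟩ := Nat.exists_eq_succ_of_ne_zero hn.ne'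
  have hlead : ∀ g : (ZMod 2)[X], g.natDegree = m + 1 →
      (reciprocalLift (m + 1) g).coeff (2 * (m + 1) - 1) = g.nextCoeff := fun g hg => by
    rw [show 2 * (m + 1) - 1 = 2 * m + 1 by omega, coeff_sub_one_reciprocalLift,
      nextCoeff_of_natDegree_pos (by omega), hg, Nat.add_sub_cancel]
  ext f
  rw [mem_selfRecipIrredLead_iff (by omega)]
  simp only [Set.mem_image, Finset.mem_coe, tracePrimes, Finset.mem_filter, mem_primesOfDegree,
    Nat.succ_eq_add_one]
  constructor
  · rintro ⟨⟨hfm, hfi, hfr, hfd⟩, ha⟩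
    obtain ⟨g, hg, rfl⟩ := exists_reciprocalLift_eq (n := m + 1) hfd.le (by
      rw [← hfd]; exact hfr)
    have hg1 : g.coeff (m + 1) = 1 := by
      rw [← coeff_two_mul_reciprocalLift, ← hfd]; exact hfm
    have hgd : g.natDegree = m + 1 :=
      le_antisymm hg (le_natDegree_of_ne_zero (by simp [hg1]))
    have hgm : g.Monic := by rw [Monic, leadingCoeff, hgd, hg1]
    obtain ⟨h0, h1⟩ := coeff_one_of_irreducible_reciprocalLift hn hgm hgd hfi
    refine ⟨g, ⟨⟨⟨hgm, hgd⟩, irreducible_of_irreducible_reciprocalLift hn hgm hgd hfi⟩,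
      by simp [h0], ?_, h1⟩, rfl⟩
    rw [← ha, hlead g hgd]
  · rintro ⟨g, ⟨⟨⟨hgm, hgd⟩, hgi⟩, h0, ha, h1⟩, rfl⟩
    obtain ⟨hQm, hQd⟩ := monic_reciprocalLift hgm hgd
    refine ⟨⟨hQm, irreducible_reciprocalLift hgm hgd hgi ((zmod_two_cases _).resolve_left h0) h1,
      ?_, hQd⟩, by rw [hlead g hgd, ha]⟩
    rw [reverse, hQd, reflect_reciprocalLift]

theorem numSelfRecip_eq_card_tracePrimes {n : ℕ} (hn : 0 < n) (a : ZMod 2) :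
    numSelfRecip (ZMod 2) n ![a] = (tracePrimes n a).card := by
  rw [numSelfRecip, selfRecipIrredLead_eq_image hn, Set.InjOn.ncard_image, Set.ncard_coe_finset]
  intro g hg h hh hgh
  have hd : ∀ k ∈ tracePrimes n a, k.natDegree = n := fun k hk =>
    (mem_primesOfDegree.1 (Finset.mem_filter.1 hk).1).1.2
  ext i
  by_cases hi : i ≤ n
  · exact coeff_eq_of_reciprocalLift_eq hgh i hi
  · rw [coeff_eq_zero_of_natDegree_lt (by rw [hd g hg]; omega),
      coeff_eq_zero_of_natDegree_lt (by rw [hd h hh]; omega)]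

end Irreducibility

/-! ### The counting formulas -/

theorem theorem4 (θ : ℝ) (hθ : θ = Real.arccos (1 / (2 * √2))) (n : ℕ) (hn : 1 ≤ n) :
    (numSelfRecip (ZMod 2) n ![1] : ℝ) =
      1 / (4 * (n : ℝ)) * ∑ j ∈ n.divisors with ¬ 2 ∣ j, (ArithmeticFunction.moebius j : ℝ) *
        ((2 : ℝ) ^ (n / j) + 1
          - (-1 : ℝ) ^ (n / j) * (2 : ℝ) ^ ((n : ℝ) / (2 * (j : ℝ)) + 1)
            * Real.cos ((n : ℝ) * θ / (j : ℝ))) ∧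
    (numSelfRecip (ZMod 2) n ![0] : ℝ) =
      1 / (4 * (n : ℝ)) * ∑ j ∈ n.divisors with ¬ 2 ∣ j, (ArithmeticFunction.moebius j : ℝ) *
        ((2 : ℝ) ^ (n / j) - 1
          + (-1 : ℝ) ^ (n / j) * (2 : ℝ) ^ ((n : ℝ) / (2 * (j : ℝ)) + 1)
            * Real.cos ((n : ℝ) * θ / (j : ℝ))) := by
  have hs1 : (1 : ℝ) ≤ √2 := Real.one_le_sqrt.2 one_le_two
  have hcos : Real.cos θ = 1 / (2 * √2) := by
    rw [hθ, Real.cos_arccos]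
    · exact le_trans (by norm_num) (by positivity : (0 : ℝ) ≤ 1 / (2 * √2))
    · rw [div_le_one (by positivity)]
      linarith
  have hn0 : (n : ℝ) ≠ 0 := by positivity
  -- As `j` divides `n`, the real exponents and angles agree with those built from the
  -- natural-number quotient `n / j`.
  have hpow : ∀ j ∈ n.divisors,
      (2 : ℝ) ^ ((n : ℝ) / (2 * (j : ℝ)) + 1) = 2 * √2 ^ (n / j) ∧
      (n : ℝ) * θ / (j : ℝ) = (n / j : ℕ) * θ := by
    intro j hj
    have hj0 : (j : ℝ) ≠ 0 := by exact_mod_cast (Nat.pos_of_mem_divisors hj).ne'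
    rw [Nat.cast_div (Nat.dvd_of_mem_divisors hj) hj0]
    refine ⟨?_, by ring⟩
    rw [← Real.rpow_natCast, Nat.cast_div (Nat.dvd_of_mem_divisors hj) hj0, Real.sqrt_eq_rpow,
      ← Real.rpow_mul (by norm_num), Real.rpow_add_one (by norm_num), mul_comm]
    congr 2
    field_simp
  have key : ∀ a, (numSelfRecip (ZMod 2) n ![a] : ℝ) = 1 / (4 * (n : ℝ)) *
      ∑ j ∈ n.divisors with ¬ 2 ∣ j, (ArithmeticFunction.moebius j : ℝ) *
        ((2 : ℝ) ^ (n / j) - signZMod a + signZMod a *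
          ((-1) ^ (n / j) * (2 * √2 ^ (n / j)) * Real.cos ((n / j : ℕ) * θ))) := by
    intro a
    have h := card_tracePrimes hcos a hn
    simp only [← mul_div_assoc, ← Finset.sum_div] at h
    rw [numSelfRecip_eq_card_tracePrimes hn, one_div, inv_mul_eq_div, eq_div_iff (by positivity)]
    linear_combination 4 * h
  refine ⟨?_, ?_⟩ <;> rw [key] <;> congr 1 <;>
    refine Finset.sum_congr rfl fun j hj => ?_ <;>
    obtain ⟨h1, h2⟩ := hpow j (Finset.mem_filter.1 hj).1 <;>
    rw [h1, h2] <;> simp only [signZMod_one, signZMod_zero] <;> ring
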